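/- Let $p,q,r\in(0,1/36)$, put $h=\frac{8}{15}$ and $a=\frac{3}{15}$, and let $\mathcal S_{pqr}=\{S_1,\dots,S_6\}$ be the system of contraction similarities of $\mathbb R$ $$S_1(x)=px,\quad S_2(x)=a+rx,\quad S_3(x)=h-qx,$$ $$S_4(x)=h-r+rx,\quad S_5(x)=1-a-rx,\quad S_6(x)=1-r+rx.$$ Let $K=K_{pqr}$ be its attractor, that is, the unique nonempty compact set with $K=\bigcup_{i=1}^6S_i(K)$. Suppose that $\mathcal S_{pqr}$ has unique one-point intersection, that is, $S_3(K)\cap S_4(K)=\{h\}$. Then the Hausdorff dimension $d=\dim_H K_{pqr}$ is finite and satisfies $$p^d+q^d+4r^d=1 .$$ -/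

import Mathlib

open scoped NNReal

/-- `K` is an attractor of the system of maps `S` on the line: a nonempty compact set with
`K = ⋃ i, S i (K)`. -/
def IsAttractor {ι : Type*} (S : ι → ℝ → ℝ) (K : Set ℝ) : Prop :=
  K.Nonempty ∧ IsCompact K ∧ K = ⋃ i, S i '' K

/-- Hutchinson's theorem on the line: a finite nonempty system of contractions has one and only one
attractor, so that one may speak of "the" attractor. -/
theorem existsUnique_isAttractor {ι : Type*} [Finite ι] [Nonempty ι] (S : ι → ℝ → ℝ)
    (c : ℝ≥0) (hc : c < 1) (hS : ∀ i, LipschitzWith c (S i)) : ∃! K, IsAttractor S K := by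
  classical
  let T : TopologicalSpace.NonemptyCompacts ℝ → TopologicalSpace.NonemptyCompacts ℝ := fun K =>
    ⟨⟨⋃ i, S i '' (K : Set ℝ),
      isCompact_iUnion fun i => K.isCompact.image (hS i).continuous⟩, by
        obtain ⟨x, hx⟩ := K.nonempty
        obtain ⟨i⟩ := ‹Nonempty ι›
        exact ⟨S i x, Set.mem_iUnion.2 ⟨i, x, hx, rfl⟩⟩⟩
  have aux : ∀ (A B : TopologicalSpace.NonemptyCompacts ℝ) (x : ℝ), x ∈ (T A : Set ℝ) →
      ∃ y ∈ (T B : Set ℝ), dist x y ≤ c * dist A B := by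
    intro A B x hx
    obtain ⟨i, a, ha, rfl⟩ := Set.mem_iUnion.1 hx
    obtain ⟨b, hb, hab⟩ := B.isCompact.exists_infDist_eq_dist B.nonempty a
    refine ⟨S i b, Set.mem_iUnion.2 ⟨i, b, hb, rfl⟩, ((hS i).dist_le_mul a b).trans ?_⟩
    refine mul_le_mul_of_nonneg_left ?_ c.2
    rw [← hab, Metric.NonemptyCompacts.dist_eq]
    exact Metric.infDist_le_hausdorffDist_of_mem ha
      (Metric.hausdorffEDist_ne_top_of_nonempty_of_bounded A.nonempty B.nonempty
        A.isCompact.isBounded B.isCompact.isBounded)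
  have hT : ContractingWith c T := by
    refine ⟨hc, LipschitzWith.of_dist_le_mul fun A B => ?_⟩
    rw [Metric.NonemptyCompacts.dist_eq]
    refine Metric.hausdorffDist_le_of_mem_dist (by positivity) (aux A B) fun x hx => ?_
    rw [dist_comm A B]
    exact aux B A x hx
  have : Nonempty (TopologicalSpace.NonemptyCompacts ℝ) := ⟨{0}⟩
  have hfix := hT.fixedPoint_isFixedPt
  refine ⟨((ContractingWith.fixedPoint T hT : TopologicalSpace.NonemptyCompacts ℝ) : Set ℝ), ⟨TopologicalSpace.NonemptyCompacts.nonempty _,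
    TopologicalSpace.NonemptyCompacts.isCompact _, ?_⟩, fun K hK => ?_⟩
  · exact congrArg (fun L : TopologicalSpace.NonemptyCompacts ℝ => (L : Set ℝ)) hfix.symm
  · obtain ⟨hne, hco, heq⟩ := hK
    have hKT : Function.IsFixedPt T ⟨⟨K, hco⟩, hne⟩ :=
      TopologicalSpace.NonemptyCompacts.ext heq.symm
    exact congrArg (fun L : TopologicalSpace.NonemptyCompacts ℝ => (L : Set ℝ))
      (hT.fixedPoint_unique hKT)

/-- The system `S_{pqr} = {S₁, …, S₆}` on the line, with `h = 8/15` and `a = 3/15`. The map with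
the index `i : Fin 6` is `S_{i+1}`. -/
noncomputable def pqrSystem (p q r : ℝ) : Fin 6 → ℝ → ℝ :=
  ![fun x => p * x,
    fun x => 3 / 15 + r * x,
    fun x => 8 / 15 - q * x,
    fun x => 8 / 15 - r + r * x,
    fun x => 1 - 3 / 15 - r * x,
    fun x => 1 - r + r * x]

/-- For all admissible parameters the attractor `K_{pqr}` exists and is unique. -/
theorem existsUnique_isAttractor_pqrSystem (p q r : ℝ) (hp : p ∈ Set.Ioo (0 : ℝ) (1 / 36))
    (hq : q ∈ Set.Ioo (0 : ℝ) (1 / 36)) (hr : r ∈ Set.Ioo (0 : ℝ) (1 / 36)) :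
    ∃! K, IsAttractor (pqrSystem p q r) K := by
  obtain ⟨hp0, hp1⟩ := hp
  obtain ⟨hq0, hq1⟩ := hq
  obtain ⟨hr0, hr1⟩ := hr
  have key : ∀ (b m : ℝ), |m| ≤ 1 / 36 → ∀ x y : ℝ,
      dist (b + m * x) (b + m * y) ≤ ((1 / 36 : ℝ≥0) : ℝ) * dist x y := by
    intro b m hm x y
    have h1 : (b + m * x) - (b + m * y) = m * (x - y) := by ring
    rw [Real.dist_eq, Real.dist_eq, h1, abs_mul]
    push_cast
    exact mul_le_mul_of_nonneg_right hm (abs_nonneg _)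
  have hpa : |p| ≤ 1 / 36 := by rw [abs_of_pos hp0]; exact hp1.le
  have hqa : |-q| ≤ 1 / 36 := by rw [abs_neg, abs_of_pos hq0]; exact hq1.le
  have hra : |r| ≤ 1 / 36 := by rw [abs_of_pos hr0]; exact hr1.le
  have hra' : |-r| ≤ 1 / 36 := by rw [abs_neg]; exact hra
  refine existsUnique_isAttractor _ (1 / 36) (by
    rw [← NNReal.coe_lt_coe]; push_cast; norm_num) fun i => LipschitzWith.of_dist_le_mul fun x y => ?_
  fin_cases i
  · simpa [pqrSystem] using key 0 p hpa x y
  · exact key (3 / 15) r hra x y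
  · have := key (8 / 15) (-q) hqa x y
    simpa [pqrSystem, sub_eq_add_neg] using this
  · exact key (8 / 15 - r) r hra x y
  · have := key (1 - 3 / 15) (-r) hra' x y
    simpa [pqrSystem, sub_eq_add_neg] using this
  · exact key (1 - r) r hra x y

/-- The unique one-point intersection property of `S_{pqr}`, for its attractor `K`: the pieces
`K₃ = S₃(K)` and `K₄ = S₄(K)` (indices `2` and `3` here) meet exactly in the point `h = 8/15`. -/
def HasUniqueOnePointIntersection (p q r : ℝ) (K : Set ℝ) : Prop :=
  pqrSystem p q r 2 '' K ∩ pqrSystem p q r 3 '' K = {8 / 15}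

open Set MeasureTheory Filter Topology

/-! Upper bound: the pieces of level `n` cover `K`, and at the root `d` of the equation the `d`-th
powers of their ratios sum to `1`.

Lower bound: the pieces `S₃(K)` and `S₄(K)` touch, so disjointness is first restored on a subsystem.
By hypothesis their only common point is `h = S₃(0)`, and `0` is reached in `[0,1]` only as `S₁(0)`.
A word containing the letter 2 therefore never produces `0`, so the maps `S_u ∘ S₂`, with `u`
running over all words of length `n`, have pairwise disjoint pieces (`wordMap_pqrSystem_injective`).
For `s < d` the ratio sum `M = p^s + q^s + 4 r^s` exceeds `1`. The subsystem has ratio sum `M^n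
r^s`, which is at least `1` for large `n`. Its attractor lies in `K`, and disjointness gives it
dimension at least `s` (`IsAttractor.le_dimH`), because it maps onto `[0,1]` by an `s`-Hölder map.
Letting `s` tend to `d` finishes the proof. -/

/-! ### Attractors and words -/

/-- The attractor of a system of contractions lies in every nonempty closed set which the maps
send into itself. -/
theorem IsAttractor.subset_of_mapsTo {ι : Type*} {S : ι → ℝ → ℝ} {E C : Set ℝ}
    (hE : IsAttractor S E) {c : ℝ} (hc : c < 1)
    (hS : ∀ i x y, dist (S i x) (S i y) ≤ c * dist x y) (hC : IsClosed C) (hne : C.Nonempty)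
    (hmaps : ∀ i, MapsTo (S i) C C) : E ⊆ C := by
  obtain ⟨hEne, hEc, hEeq⟩ := hE
  have step : ∀ i x, Metric.infDist (S i x) C ≤ c * Metric.infDist x C := by
    intro i x
    obtain ⟨y, hy, hxy⟩ := hC.exists_infDist_eq_dist hne x
    rw [hxy]
    exact (Metric.infDist_le_dist_of_mem (hmaps i hy)).trans (hS i x y)
  obtain ⟨z, hz, hmax⟩ := hEc.exists_isMaxOn hEne (Metric.continuous_infDist_pt C).continuousOn
  have hz' := hz
  rw [hEeq] at hz'
  obtain ⟨i, y, hy, rfl⟩ := mem_iUnion.1 hz'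
  -- At a point `S i y` of `E` farthest from `C`, the preimage `y` is no farther away, while `S i`
  -- shrinks its distance by the factor `c < 1`; so the maximal distance is `0`.
  have h1 : Metric.infDist y C ≤ Metric.infDist (S i y) C := hmax hy
  have h2 := step i y
  have h0 : 0 ≤ Metric.infDist y C := Metric.infDist_nonneg
  have hy0 : Metric.infDist y C = 0 := by nlinarith
  intro x hx
  have h3 : Metric.infDist x C ≤ Metric.infDist (S i y) C := hmax hx
  rw [hC.mem_iff_infDist_zero hne]
  refine le_antisymm ?_ Metric.infDist_nonneg
  rw [hy0] at h2
  linarith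

theorem IsAttractor.mapsTo {ι : Type*} {S : ι → ℝ → ℝ} {E : Set ℝ} (hE : IsAttractor S E) (i : ι) :
    MapsTo (S i) E E := fun x hx => by
  rw [hE.2.2]
  exact mem_iUnion.2 ⟨i, x, hx, rfl⟩

/-- The composition of the maps of a system along a word. -/
def wordMap {ι : Type*} (S : ι → ℝ → ℝ) : (n : ℕ) → (Fin n → ι) → ℝ → ℝ
  | 0, _ => id
  | n + 1, u => S (u 0) ∘ wordMap S n (Fin.tail u)

theorem dist_wordMap {ι : Type*} {S : ι → ℝ → ℝ} {ρ : ι → ℝ}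
    (hS : ∀ i x y, dist (S i x) (S i y) = ρ i * dist x y) (n : ℕ) (u : Fin n → ι) (x y : ℝ) :
    dist (wordMap S n u x) (wordMap S n u y) = (∏ k, ρ (u k)) * dist x y := by
  induction n with
  | zero => simp [wordMap]
  | succ n ih =>
    rw [Fin.prod_univ_succ, mul_assoc]
    simp only [wordMap, Function.comp_apply, hS, ih]
    rfl

theorem IsAttractor.mapsTo_wordMap {ι : Type*} {S : ι → ℝ → ℝ} {E : Set ℝ} (hE : IsAttractor S E)
    (n : ℕ) (u : Fin n → ι) : MapsTo (wordMap S n u) E E := by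
  induction n with
  | zero => exact mapsTo_id E
  | succ n ih => exact (hE.mapsTo (u 0)).comp (ih (Fin.tail u))

theorem IsAttractor.subset_iUnion_wordMap {ι : Type*} {S : ι → ℝ → ℝ} {E : Set ℝ}
    (hE : IsAttractor S E) (n : ℕ) : E ⊆ ⋃ u, wordMap S n u '' E := by
  induction n with
  | zero => exact fun x hx => mem_iUnion.2 ⟨Fin.elim0, x, hx, rfl⟩
  | succ n ih =>
    intro x hx
    rw [hE.2.2] at hx
    obtain ⟨i, y, hy, rfl⟩ := mem_iUnion.1 hx
    obtain ⟨u, z, hz, rfl⟩ := mem_iUnion.1 (ih hy)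
    exact mem_iUnion.2 ⟨Fin.cons i u, z, hz, by simp [wordMap]⟩

/-! ### Upper bound by natural covers -/

/-- The similarity dimension bounds the Hausdorff dimension of an attractor from above. -/
theorem IsAttractor.dimH_le {ι : Type*} [Fintype ι] {S : ι → ℝ → ℝ} {ρ : ι → ℝ} {E : Set ℝ}
    (hE : IsAttractor S E) (hρ : ∀ i, 0 < ρ i) {c : ℝ} (hc : c < 1) (hρc : ∀ i, ρ i ≤ c)
    (hS : ∀ i x y, dist (S i x) (S i y) = ρ i * dist x y) (hE1 : Metric.diam E ≤ 1)
    {d : ℝ≥0} (hd : ∑ i, ρ i ^ (d : ℝ) ≤ 1) : dimH E ≤ d := by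
  have hc0 : 0 ≤ c := by
    obtain ⟨x, hx⟩ := hE.1
    rw [hE.2.2] at hx
    obtain ⟨i, -⟩ := mem_iUnion.1 hx
    exact (hρ i).le.trans (hρc i)
  have hprod : ∀ n (u : Fin n → ι), 0 ≤ ∏ k, ρ (u k) := fun n u =>
    Finset.prod_nonneg fun k _ => (hρ _).le
  have hbd := hE.2.1.isBounded
  have hdiam : ∀ n (u : Fin n → ι),
      Metric.ediam (wordMap S n u '' E) ≤ ENNReal.ofReal (∏ k, ρ (u k)) := by
    intro n u
    refine Metric.ediam_le ?_
    rintro _ ⟨x, hx, rfl⟩ _ ⟨y, hy, rfl⟩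
    rw [edist_dist, dist_wordMap hS]
    exact ENNReal.ofReal_le_ofReal (mul_le_of_le_one_right (hprod n u)
      ((Metric.dist_le_diam_of_mem hbd hx hy).trans hE1))
  have hmeas : μH[(d : ℝ)] E ≤ 1 := by
    refine (Measure.hausdorffMeasure_le_liminf_sum (ι := fun n : ℕ => (Fin n → ι))
      (l := atTop) (d : ℝ) E (fun n => ENNReal.ofReal (c ^ n)) ?_
      (fun n u => wordMap S n u '' E) ?_ ?_).trans ?_
    · rw [← ENNReal.ofReal_zero]
      exact ENNReal.tendsto_ofReal (tendsto_pow_atTop_nhds_zero_of_lt_one hc0 hc)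
    · refine Eventually.of_forall fun n u => (hdiam n u).trans (ENNReal.ofReal_le_ofReal ?_)
      refine (Finset.prod_le_prod (fun k _ => (hρ _).le) fun k _ => hρc (u k)).trans ?_
      simp
    · exact Eventually.of_forall fun n => hE.subset_iUnion_wordMap n
    · refine liminf_le_of_frequently_le' (Frequently.of_forall fun n => ?_)
      calc ∑ u : Fin n → ι, Metric.ediam (wordMap S n u '' E) ^ (d : ℝ)
          ≤ ∑ u : Fin n → ι, ENNReal.ofReal (∏ k, ρ (u k) ^ (d : ℝ)) := by
            refine Finset.sum_le_sum fun u _ => ?_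
            rw [Real.finsetProd_rpow _ _ fun k _ => (hρ _).le,
              ← ENNReal.ofReal_rpow_of_nonneg (hprod n u) d.coe_nonneg]
            exact ENNReal.rpow_le_rpow (hdiam n u) d.coe_nonneg
        -- The products over all words of length `n` are the terms of the expanded `n`-th power.
        _ = ENNReal.ofReal ((∑ i, ρ i ^ (d : ℝ)) ^ n) := by
            rw [Fintype.sum_pow, ENNReal.ofReal_sum_of_nonneg]
            exact fun u _ => Finset.prod_nonneg fun k _ => Real.rpow_nonneg (hρ _).le _
        _ ≤ 1 := by
            rw [← ENNReal.ofReal_one]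
            exact ENNReal.ofReal_le_ofReal (pow_le_one₀
              (Finset.sum_nonneg fun i _ => Real.rpow_nonneg (hρ _).le _) hd)
  exact dimH_le_of_hausdorffMeasure_ne_top (hmeas.trans_lt ENNReal.one_lt_top).ne

/-! ### Lower bound for disjoint pieces -/

/-- The unit interval is cut into consecutive intervals of prescribed lengths. -/
theorem exists_Icc_subset_biUnion_Icc {ι : Type*} (w : ι → ℝ) (hw : ∀ i, 0 ≤ w i) {s : Finset ι}
    (hs : s.Nonempty) : ∃ b : ι → ℝ, (∀ i ∈ s, 0 ≤ b i ∧ b i + w i ≤ ∑ j ∈ s, w j) ∧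
      Icc 0 (∑ j ∈ s, w j) ⊆ ⋃ i ∈ s, Icc (b i) (b i + w i) := by
  classical
  induction hs using Finset.Nonempty.cons_induction with
  | singleton a => exact ⟨0, by simp, by simp⟩
  | cons a s ha hs ih =>
    obtain ⟨b, hb, hcov⟩ := ih
    have hne : ∀ i ∈ s, i ≠ a := fun i hi h => ha (h ▸ hi)
    have hsum : 0 ≤ ∑ j ∈ s, w j := Finset.sum_nonneg fun i _ => hw i
    -- The new interval is appended at the right end of those already placed.
    refine ⟨Function.update b a (∑ j ∈ s, w j), fun i hi => ?_, fun x hx => ?_⟩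
    · rw [Finset.sum_cons]
      rcases Finset.mem_cons.1 hi with rfl | hi
      · simp [hsum, add_comm]
      · rw [Function.update_of_ne (hne i hi)]
        exact ⟨(hb i hi).1, by linarith [(hb i hi).2, hw a]⟩
    · rw [Finset.sum_cons] at hx
      rcases le_total x (∑ j ∈ s, w j) with h | h
      · obtain ⟨i, hi, hxi⟩ := mem_iUnion₂.1 (hcov ⟨hx.1, h⟩)
        refine mem_iUnion₂.2 ⟨i, Finset.mem_cons_of_mem hi, ?_⟩
        rwa [Function.update_of_ne (hne i hi)]
      · refine mem_iUnion₂.2 ⟨a, Finset.mem_cons_self a s, ?_⟩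
        rw [Function.update_self]
        exact ⟨h, by linarith [hx.2]⟩

/-- Pairwise disjoint compact sets, finite in number, are at positive distances. -/
theorem exists_pos_forall_le_dist_of_pairwise_disjoint {ι : Type*} [Finite ι] {A : ι → Set ℝ}
    (hA : ∀ i, IsCompact (A i)) (hdisj : Pairwise fun i j => Disjoint (A i) (A j)) :
    ∃ δ > 0, ∀ i j, i ≠ j → ∀ x ∈ A i, ∀ y ∈ A j, δ ≤ dist x y := by
  have : ∀ᶠ δ in 𝓝[>] (0 : ℝ), ∀ i j, i ≠ j → ∀ x ∈ A i, ∀ y ∈ A j, δ ≤ dist x y := by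
    refine eventually_all.2 fun i => eventually_all.2 fun j => ?_
    by_cases hij : i = j
    · exact Eventually.of_forall fun _ h => absurd hij h
    obtain ⟨r, hr, h⟩ := Metric.exists_pos_forall_lt_edist (hA i) (hA j).isClosed (hdisj hij)
    filter_upwards [Ioo_mem_nhdsGT (NNReal.coe_pos.2 hr)] with δ hδ _ x hx y hy
    have := h x hx y hy
    rw [edist_nndist, ENNReal.coe_lt_coe, ← NNReal.coe_lt_coe, coe_nndist] at this
    exact hδ.2.le.trans this.le
  obtain ⟨δ, h, hδ⟩ := (this.and self_mem_nhdsWithin).exists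
  exact ⟨δ, hδ, h⟩

/-- If the pieces of an attractor are pairwise disjoint, and the weights `w i` add up to one and are
at most `ρ i ^ s`, then the attractor is mapped onto the unit interval by an `s`-Hölder map. -/
theorem IsAttractor.exists_holderOnWith_surjOn {ι : Type*} [Fintype ι] {S : ι → ℝ → ℝ} {ρ : ι → ℝ}
    {E : Set ℝ} (hE : IsAttractor S E) (hρ : ∀ i, 0 < ρ i)
    (hS : ∀ i x y, dist (S i x) (S i y) = ρ i * dist x y)
    (hdisj : Pairwise fun i j => Disjoint (S i '' E) (S j '' E)) {s : ℝ≥0} (hs : 0 < s)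
    {w : ι → ℝ} (hw : ∀ i, 0 ≤ w i) {c : ℝ} (hc : c < 1) (hwc : ∀ i, w i ≤ c)
    (hwρ : ∀ i, w i ≤ ρ i ^ (s : ℝ)) (hsum : ∑ i, w i = 1) :
    ∃ (C : ℝ≥0) (f : ℝ → ℝ), HolderOnWith C s f E ∧ Icc 0 1 ⊆ f '' E := by
  have : Nonempty ι := by
    obtain ⟨x, hx⟩ := hE.1
    rw [hE.2.2] at hx
    exact (mem_iUnion.1 hx).nonempty
  have hc0 : 0 ≤ c := (hw (Classical.arbitrary ι)).trans (hwc _)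
  obtain ⟨b, hb, hcov⟩ := exists_Icc_subset_biUnion_Icc w hw (Finset.univ_nonempty (α := ι))
  simp only [Finset.mem_univ, forall_const, hsum, iUnion_true] at hb hcov
  have hinj : ∀ i, Function.Injective (S i) := fun i x y h => by
    have := hS i x y
    rw [h, dist_self, zero_eq_mul] at this
    exact dist_eq_zero.1 (this.resolve_left (hρ i).ne')
  have hcont : ∀ i, Continuous (S i) := fun i =>
    (LipschitzWith.of_dist_le_mul (K := ⟨ρ i, (hρ i).le⟩) fun x y => (hS i x y).le).continuous
  obtain ⟨δ, hδ, hsep⟩ := exists_pos_forall_le_dist_of_pairwise_disjoint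
    (fun i => hE.2.1.image (hcont i)) hdisj
  have hex : ∀ x ∈ E, ∃ i y, y ∈ E ∧ S i y = x := fun x hx => by
    rw [hE.2.2] at hx
    exact mem_iUnion.1 hx
  -- `k x` is the first letter of the address of `x`, and `σ` is the shift.
  choose! k σ hσE hσ using hex
  -- Iterates, starting from `0`, of the functional equation `f x = b (k x) + w (k x) * f (σ x)`;
  -- they converge geometrically on `E`, and their limit is the desired map.
  let F : ℕ → ℝ → ℝ := fun n => n.rec (fun _ => 0) fun _ g x => b (k x) + w (k x) * g (σ x)
  have hF : ∀ n x, F (n + 1) x = b (k x) + w (k x) * F n (σ x) := fun _ _ => rfl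
  have hF01 : ∀ n, ∀ x ∈ E, F n x ∈ Icc (0 : ℝ) 1 := by
    intro n
    induction n with
    | zero => exact fun x _ => ⟨le_rfl, zero_le_one⟩
    | succ n ih =>
      intro x hx
      obtain ⟨h0, h1⟩ := ih (σ x) (hσE x hx)
      rw [hF]
      exact ⟨add_nonneg (hb _).1 (mul_nonneg (hw _) h0),
        (add_le_add_right (mul_le_of_le_one_right (hw _) h1) _).trans (hb _).2⟩
  have hstep : ∀ n, ∀ x ∈ E, dist (F n x) (F (n + 1) x) ≤ 1 * c ^ n := by
    intro n
    induction n with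
    | zero =>
      intro x hx
      have := hF01 1 x hx
      rw [dist_comm, Real.dist_eq, show F 0 x = 0 from rfl, sub_zero, zero_add, abs_of_nonneg this.1]
      simpa using this.2
    | succ n ih =>
      intro x hx
      rw [hF (n + 1), hF n, dist_add_left, Real.dist_eq, ← mul_sub, abs_mul, abs_of_nonneg (hw _),
        pow_succ', one_mul]
      refine mul_le_mul (hwc _) ?_ (abs_nonneg _) hc0
      simpa [Real.dist_eq] using ih (σ x) (hσE x hx)
  have hlim : ∀ x ∈ E, ∃ l, Tendsto (fun n => F n x) atTop (𝓝 l) := fun x hx =>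
    cauchySeq_tendsto_of_complete (cauchySeq_of_le_geometric c 1 hc fun n => hstep n x hx)
  choose! f hf using hlim
  have hfun : ∀ x ∈ E, f x = b (k x) + w (k x) * f (σ x) := fun x hx =>
    tendsto_nhds_unique ((hf x hx).comp (tendsto_add_atTop_nat 1))
      (((hf _ (hσE x hx)).const_mul _).const_add _)
  -- The Hölder constant does not depend on `n`: within one piece the factor `w i ≤ ρ i ^ s` is
  -- absorbed by the scaling of distances; points of different pieces are at least `δ` apart, while
  -- the values differ by at most `1`.
  have hFh : ∀ n, ∀ x ∈ E, ∀ y ∈ E,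
      dist (F n x) (F n y) ≤ (δ ^ (s : ℝ))⁻¹ * dist x y ^ (s : ℝ) := by
    intro n
    have hδs : 0 < δ ^ (s : ℝ) := Real.rpow_pos_of_pos hδ _
    induction n with
    | zero =>
      intro x _ y _
      rw [show F 0 x = F 0 y from rfl, dist_self]
      positivity
    | succ n ih =>
      intro x hx y hy
      by_cases h : k x = k y
      · have h1 : dist x y = ρ (k y) * dist (σ x) (σ y) := by
          rw [← hS, ← h, hσ x hx, h, hσ y hy]
        rw [hF, hF, h, dist_add_left, Real.dist_eq, ← mul_sub, abs_mul, abs_of_nonneg (hw _), h1,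
          Real.mul_rpow (hρ _).le dist_nonneg, mul_left_comm]
        exact mul_le_mul (hwρ _) (ih _ (hσE x hx) _ (hσE y hy)) (abs_nonneg _)
          (Real.rpow_nonneg (hρ _).le _)
      · have h1 : δ ≤ dist x y :=
          hsep _ _ h x ⟨σ x, hσE x hx, hσ x hx⟩ y ⟨σ y, hσE y hy, hσ y hy⟩
        have h2 := Real.dist_le_of_mem_Icc_01 (hF01 (n + 1) x hx) (hF01 (n + 1) y hy)
        refine h2.trans ?_
        rw [inv_mul_eq_div, one_le_div hδs]
        exact Real.rpow_le_rpow hδ.le h1 s.2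
  have hfh : ∀ x ∈ E, ∀ y ∈ E, dist (f x) (f y) ≤ (δ ^ (s : ℝ))⁻¹ * dist x y ^ (s : ℝ) :=
    fun x hx y hy => le_of_tendsto ((hf x hx).dist (hf y hy)) (Eventually.of_forall fun n =>
      hFh n x hx y hy)
  have hhold : HolderOnWith (δ ^ (s : ℝ))⁻¹.toNNReal s f E := by
    intro x hx y hy
    rw [edist_dist, edist_dist, ENNReal.ofReal_rpow_of_nonneg dist_nonneg s.coe_nonneg,
      ← ENNReal.ofReal, ← ENNReal.ofReal_mul (by positivity)]
    exact ENNReal.ofReal_le_ofReal (hfh x hx y hy)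
  refine ⟨_, f, hhold, ?_⟩
  -- Surjectivity: `[0,1]` is the attractor of the affine maps `b i + w i * x`, and the compact set
  -- `f '' E` is sent into itself by them.
  have hIcc : IsAttractor (fun i x => b i + w i * x) (Icc (0 : ℝ) 1) := by
    refine ⟨⟨0, by simp⟩, isCompact_Icc, Subset.antisymm (fun x hx => ?_) ?_⟩
    · obtain ⟨i, hi⟩ := mem_iUnion.1 (hcov hx)
      refine mem_iUnion.2 ⟨i, (x - b i) / w i, ?_, ?_⟩
      · exact ⟨div_nonneg (by linarith [hi.1]) (hw i),
          div_le_one_of_le₀ (by linarith [hi.2]) (hw i)⟩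
      -- If `w i = 0`, the interval is the point `b i` and the quotient takes the default value `0`.
      · rcases (hw i).eq_or_lt with h | h
        · rw [← h] at hi
          simp only [← h]
          linarith [hi.1, hi.2]
        · field_simp
          ring
    · refine iUnion_subset fun i => ?_
      rintro _ ⟨x, hx, rfl⟩
      exact ⟨add_nonneg (hb _).1 (mul_nonneg (hw _) hx.1),
        (add_le_add_right (mul_le_of_le_one_right (hw _) hx.2) _).trans (hb _).2⟩
  refine hIcc.subset_of_mapsTo hc (fun i x y => ?_)
    (hE.2.1.image_of_continuousOn (hhold.continuousOn hs)).isClosed (hE.1.image f) ?_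
  · rw [dist_add_left, Real.dist_eq, ← mul_sub, abs_mul, abs_of_nonneg (hw _)]
    exact mul_le_mul_of_nonneg_right (hwc i) (abs_nonneg _)
  · rintro i _ ⟨x, hx, rfl⟩
    have hx' := hE.mapsTo i hx
    have hk : k (S i x) = i := by
      by_contra h
      exact disjoint_left.1 (hdisj h) ⟨_, hσE _ hx', hσ _ hx'⟩ ⟨x, hx, rfl⟩
    have hσx : σ (S i x) = x := by
      have := hσ _ hx'
      rw [hk] at this
      exact hinj i this
    exact ⟨S i x, hx', by rw [hfun _ hx', hk, hσx]⟩

/-- The similarity dimension bounds the Hausdorff dimension of an attractor with pairwise disjoint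
pieces from below. -/
theorem IsAttractor.le_dimH {ι : Type*} [Fintype ι] {S : ι → ℝ → ℝ} {ρ : ι → ℝ}
    {E : Set ℝ} (hE : IsAttractor S E) (hρ : ∀ i, 0 < ρ i) (hρ1 : ∀ i, ρ i < 1)
    (hS : ∀ i x y, dist (S i x) (S i y) = ρ i * dist x y)
    (hdisj : Pairwise fun i j => Disjoint (S i '' E) (S j '' E)) {s : ℝ≥0} (hs : 0 < s)
    (hsum : 1 ≤ ∑ i, ρ i ^ (s : ℝ)) : s ≤ dimH E := by
  set M := ∑ i, ρ i ^ (s : ℝ) with hM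
  have hM0 : 0 < M := zero_lt_one.trans_le hsum
  have hpos : ∀ i, 0 < ρ i ^ (s : ℝ) := fun i => Real.rpow_pos_of_pos (hρ i) _
  -- Division by `M ≥ 1` makes the weights sum to one and keeps them below `ρ i ^ s`.
  have hle : ∀ i, ρ i ^ (s : ℝ) / M ≤ ρ i ^ (s : ℝ) := fun i => div_le_self (hpos i).le hsum
  have hlt : ∀ i, ρ i ^ (s : ℝ) / M < 1 := fun i =>
    (hle i).trans_lt (Real.rpow_lt_one (hρ i).le (hρ1 i) hs)
  obtain ⟨c, hc, hwc⟩ : ∃ c < 1, ∀ i, ρ i ^ (s : ℝ) / M ≤ c := by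
    have : ∀ᶠ c in 𝓝[<] (1 : ℝ), ∀ i, ρ i ^ (s : ℝ) / M ≤ c := eventually_all.2 fun i => by
      filter_upwards [Ioo_mem_nhdsLT (hlt i)] with c h using h.1.le
    obtain ⟨c, h, hc⟩ := (this.and self_mem_nhdsWithin).exists
    exact ⟨c, hc, h⟩
  obtain ⟨C, f, hf, hsurj⟩ := hE.exists_holderOnWith_surjOn hρ hS hdisj hs
    (fun i => (div_pos (hpos i) hM0).le) hc hwc hle (by rw [← Finset.sum_div, ← hM, div_self hM0.ne'])
  -- An `s`-Hölder map raises dimension at most by the factor `1 / s`, and its image contains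
  -- `[0,1]`.
  have h1 : (1 : ENNReal) ≤ dimH E / s := by
    refine le_trans ?_ ((dimH_mono hsurj).trans (hf.dimH_image_le hs))
    rw [Real.dimH_of_nonempty_interior (by simp [interior_Icc])]
    simp
  rwa [ENNReal.le_div_iff_mul_le (by simp [hs.ne']) (by simp), one_mul] at h1

/-! ### Position of the pieces of `S_{pqr}` -/

/-- The contraction ratios of the system `S_{pqr}`. -/
def pqrRatio (p q r : ℝ) : Fin 6 → ℝ := ![p, r, q, r, r, r]

theorem dist_pqrSystem {p q r : ℝ} (hp : 0 < p) (hq : 0 < q) (hr : 0 < r) (i : Fin 6) (x y : ℝ) :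
    dist (pqrSystem p q r i x) (pqrSystem p q r i y) = pqrRatio p q r i * dist x y := by
  have key : ∀ m : ℝ, 0 < m → m * dist x y = |m * (x - y)| := fun m hm => by
    rw [abs_mul, abs_of_pos hm, Real.dist_eq]
  fin_cases i <;> simp only [pqrSystem, pqrRatio, Fin.reduceFinMk, Fin.isValue, Matrix.cons_val,
    Fin.zero_eta, Fin.mk_one]
  · rw [key p hp, Real.dist_eq]; congr 1; ring
  · rw [key r hr, Real.dist_eq]; congr 1; ring
  · rw [key q hq, Real.dist_eq, ← abs_neg]; congr 1; ring
  · rw [key r hr, Real.dist_eq]; congr 1; ring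
  · rw [key r hr, Real.dist_eq, ← abs_neg]; congr 1; ring
  · rw [key r hr, Real.dist_eq]; congr 1; ring

theorem pqrRatio_mem_Ioo {p q r : ℝ} (hp : p ∈ Ioo (0 : ℝ) (1 / 36)) (hq : q ∈ Ioo (0 : ℝ) (1 / 36))
    (hr : r ∈ Ioo (0 : ℝ) (1 / 36)) (i : Fin 6) : pqrRatio p q r i ∈ Ioo (0 : ℝ) (1 / 36) := by
  fin_cases i
  exacts [hp, hr, hq, hr, hr, hr]

theorem sum_pqrRatio_rpow (p q r s : ℝ) :
    ∑ i, pqrRatio p q r i ^ s = p ^ s + q ^ s + 4 * r ^ s := by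
  simp only [Fin.sum_univ_six, pqrRatio, Fin.isValue, Matrix.cons_val]
  ring

theorem mul_mem_Icc {m x : ℝ} (hm : m ∈ Ioo (0 : ℝ) (1 / 36)) (hx : x ∈ Icc (0 : ℝ) 1) :
    m * x ∈ Icc (0 : ℝ) (1 / 36) :=
  ⟨mul_nonneg hm.1.le hx.1, by nlinarith [hm.1, hm.2, hx.1, hx.2]⟩

section

variable {p q r : ℝ} (hp : p ∈ Ioo (0 : ℝ) (1 / 36)) (hq : q ∈ Ioo (0 : ℝ) (1 / 36))
  (hr : r ∈ Ioo (0 : ℝ) (1 / 36))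

include hp hq hr

theorem injective_pqrSystem (i : Fin 6) : Function.Injective (pqrSystem p q r i) := fun x y h => by
  have := dist_pqrSystem hp.1 hq.1 hr.1 i x y
  rw [h, dist_self, zero_eq_mul] at this
  exact dist_eq_zero.1 (this.resolve_left (pqrRatio_mem_Ioo hp hq hr i).1.ne')

theorem mapsTo_pqrSystem_Icc (i : Fin 6) : MapsTo (pqrSystem p q r i) (Icc 0 1) (Icc 0 1) := by
  intro x hx
  obtain ⟨hp1, hp2⟩ := mul_mem_Icc hp hx
  obtain ⟨hq1, hq2⟩ := mul_mem_Icc hq hx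
  obtain ⟨hr1, hr2⟩ := mul_mem_Icc hr hx
  obtain ⟨hr3, hr4⟩ := hr
  have hr5 : r * x ≤ r := mul_le_of_le_one_right hr3.le hx.2
  fin_cases i <;> simp only [pqrSystem, Fin.reduceFinMk, Fin.isValue, Matrix.cons_val,
    Fin.zero_eta, Fin.mk_one] <;> constructor <;> linarith

theorem eq_zero_of_pqrSystem_eq_zero {i : Fin 6} {x : ℝ} (hx : x ∈ Icc (0 : ℝ) 1)
    (h : pqrSystem p q r i x = 0) : i = 0 ∧ x = 0 := by
  obtain ⟨hq1, hq2⟩ := mul_mem_Icc hq hx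
  obtain ⟨hr1, hr2⟩ := mul_mem_Icc hr hx
  obtain ⟨hr3, hr4⟩ := hr
  fin_cases i <;> simp only [pqrSystem, Fin.reduceFinMk, Fin.isValue, Matrix.cons_val,
    Fin.zero_eta, Fin.mk_one] at h
  · exact ⟨rfl, (mul_eq_zero.1 h).resolve_left hp.1.ne'⟩
  all_goals exfalso; linarith

/-- Of the images of the unit interval only the third and the fourth one meet. -/
theorem eq_two_three_of_pqrSystem_eq {i j : Fin 6} (hij : i ≠ j) {x y : ℝ}
    (hx : x ∈ Icc (0 : ℝ) 1) (hy : y ∈ Icc (0 : ℝ) 1)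
    (h : pqrSystem p q r i x = pqrSystem p q r j y) : i = 2 ∧ j = 3 ∨ i = 3 ∧ j = 2 := by
  obtain ⟨hp1, hp2⟩ := mul_mem_Icc hp hx
  obtain ⟨hq1, hq2⟩ := mul_mem_Icc hq hx
  obtain ⟨hr1, hr2⟩ := mul_mem_Icc hr hx
  obtain ⟨hp3, hp4⟩ := mul_mem_Icc hp hy
  obtain ⟨hq3, hq4⟩ := mul_mem_Icc hq hy
  obtain ⟨hr3, hr4⟩ := mul_mem_Icc hr hy
  obtain ⟨hr5, hr6⟩ := hr
  fin_cases i <;> fin_cases j <;> simp only [pqrSystem, Fin.reduceFinMk, Fin.isValue,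
    Matrix.cons_val, Fin.zero_eta, Fin.mk_one, ne_eq, not_true_eq_false] at h hij
  all_goals first | exact Or.inl ⟨rfl, rfl⟩ | exact Or.inr ⟨rfl, rfl⟩ | (exfalso; linarith)

variable {K : Set ℝ} (hK : IsAttractor (pqrSystem p q r) K)

include hK

theorem IsAttractor.subset_Icc_of_pqrSystem : K ⊆ Icc 0 1 :=
  hK.subset_of_mapsTo (c := 1 / 36) (by norm_num) (fun i x y => by
    rw [dist_pqrSystem hp.1 hq.1 hr.1]
    exact mul_le_mul_of_nonneg_right (pqrRatio_mem_Ioo hp hq hr i).2.le dist_nonneg)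
    isClosed_Icc (nonempty_Icc.2 zero_le_one) (mapsTo_pqrSystem_Icc hp hq hr)

/-- Going down the word, a zero value forces a zero argument at each letter, until `S₂` would have
to vanish on `[0,1]`. -/
theorem wordMap_pqrSystem_ne_zero (n : ℕ) (u : Fin n → Fin 6) {x : ℝ} (hx : x ∈ K) :
    wordMap (pqrSystem p q r) n u (pqrSystem p q r 1 x) ≠ 0 := by
  have hK01 := hK.subset_Icc_of_pqrSystem hp hq hr
  induction n with
  | zero =>
    intro h
    exact absurd (eq_zero_of_pqrSystem_eq_zero hp hq hr (i := 1) (hK01 hx) h).1 (by decide)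
  | succ n ih =>
    intro h
    exact ih (Fin.tail u) (eq_zero_of_pqrSystem_eq_zero hp hq hr
      (hK01 (hK.mapsTo_wordMap n _ (hK.mapsTo 1 hx))) h).2

/-- Under unique one-point intersection, words of a given length that are continued by the second
letter have pairwise disjoint pieces. -/
theorem wordMap_pqrSystem_injective (hone : HasUniqueOnePointIntersection p q r K) (n : ℕ)
    (u v : Fin n → Fin 6) {x y : ℝ} (hx : x ∈ K) (hy : y ∈ K)
    (h : wordMap (pqrSystem p q r) n u (pqrSystem p q r 1 x) =
      wordMap (pqrSystem p q r) n v (pqrSystem p q r 1 y)) : u = v := by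
  have hK01 := hK.subset_Icc_of_pqrSystem hp hq hr
  have hmem : ∀ (n : ℕ) (u : Fin n → Fin 6) {x : ℝ}, x ∈ K →
      wordMap (pqrSystem p q r) n u (pqrSystem p q r 1 x) ∈ K := fun n u x hx =>
    hK.mapsTo_wordMap n u (hK.mapsTo 1 hx)
  -- A common point of the third and fourth pieces is `8 / 15 = S₃(0)`, so injectivity of `S₃` would
  -- make the inner point `0`.
  have key : ∀ {n : ℕ} {u v : Fin n → Fin 6} {x y : ℝ}, x ∈ K → y ∈ K →
      pqrSystem p q r 2 (wordMap (pqrSystem p q r) n u (pqrSystem p q r 1 x)) ≠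
      pqrSystem p q r 3 (wordMap (pqrSystem p q r) n v (pqrSystem p q r 1 y)) := by
    intro n u v x y hx hy h
    have h1 : pqrSystem p q r 2 (wordMap (pqrSystem p q r) n u (pqrSystem p q r 1 x)) = 8 / 15 :=
      hone.subset ⟨⟨_, hmem n u hx, rfl⟩, ⟨_, hmem n v hy, h.symm⟩⟩
    have h2 : pqrSystem p q r 2 0 = 8 / 15 := by simp [pqrSystem]
    exact wordMap_pqrSystem_ne_zero hp hq hr hK n u hx
      (injective_pqrSystem hp hq hr 2 (h1.trans h2.symm))
  induction n with
  | zero => exact Subsingleton.elim u v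
  | succ n ih =>
    simp only [wordMap, Function.comp_apply] at h
    by_cases h0 : u 0 = v 0
    · rw [h0] at h
      rw [← Fin.cons_self_tail u, ← Fin.cons_self_tail v, h0,
        ih _ _ (injective_pqrSystem hp hq hr _ h)]
    · rcases eq_two_three_of_pqrSystem_eq hp hq hr h0 (hK01 (hmem n _ hx)) (hK01 (hmem n _ hy)) h
        with ⟨h1, h2⟩ | ⟨h1, h2⟩
      · rw [h1, h2] at h
        exact (key hx hy h).elim
      · rw [h1, h2] at h
        exact (key hy hx h.symm).elim

/-! ### The disjoint subsystem and the dimension formula -/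

theorem le_dimH_of_one_lt_sum (hone : HasUniqueOnePointIntersection p q r K) {s : ℝ≥0} (hs : 0 < s)
    (hsum : 1 < ∑ i, pqrRatio p q r i ^ (s : ℝ)) : s ≤ dimH K := by
  -- `n` is so large that the `n`-th power of the sum outweighs the factor `r ^ s` lost to the
  -- appended letter.
  obtain ⟨n, hn⟩ := pow_unbounded_of_one_lt (r ^ (s : ℝ))⁻¹ hsum
  have hrs : 0 < r ^ (s : ℝ) := Real.rpow_pos_of_pos hr.1 _
  have hρ : ∀ i, pqrRatio p q r i ∈ Ioo (0 : ℝ) (1 / 36) := pqrRatio_mem_Ioo hp hq hr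
  let T : (Fin n → Fin 6) → ℝ → ℝ := fun u => wordMap (pqrSystem p q r) n u ∘ pqrSystem p q r 1
  let τ : (Fin n → Fin 6) → ℝ := fun u => (∏ k, pqrRatio p q r (u k)) * r
  have hT : ∀ u x y, dist (T u x) (T u y) = τ u * dist x y := fun u x y => by
    have hS := dist_pqrSystem hp.1 hq.1 hr.1
    simp only [T, τ, Function.comp_apply, dist_wordMap hS, hS, mul_assoc]
    rfl
  have hprod : ∀ u : Fin n → Fin 6, 0 < ∏ k, pqrRatio p q r (u k) := fun u =>
    Finset.prod_pos fun k _ => (hρ _).1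
  have hτ : ∀ u, 0 < τ u := fun u => mul_pos (hprod u) hr.1
  have hτ1 : ∀ u, τ u ≤ 1 / 36 := fun u => by
    refine (mul_le_of_le_one_left hr.1.le ?_).trans hr.2.le
    exact Finset.prod_le_one (fun k _ => (hρ _).1.le) fun k _ => by linarith [(hρ (u k)).2]
  obtain ⟨E, hE, -⟩ := existsUnique_isAttractor T (1 / 36)
    (by rw [← NNReal.coe_lt_coe]; push_cast; norm_num)
    fun u => LipschitzWith.of_dist_le_mul fun x y => by
      rw [hT]
      push_cast
      exact mul_le_mul_of_nonneg_right (hτ1 u) dist_nonneg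
  have hEK : E ⊆ K := hE.subset_of_mapsTo (c := 1 / 36) (by norm_num)
    (fun u x y => (hT u x y).trans_le (mul_le_mul_of_nonneg_right (hτ1 u) dist_nonneg))
    hK.2.1.isClosed hK.1 fun u => (hK.mapsTo_wordMap n u).comp (hK.mapsTo 1)
  refine (hE.le_dimH hτ (fun u => (hτ1 u).trans_lt (by norm_num)) hT ?_ hs ?_).trans (dimH_mono hEK)
  · intro u v huv
    rw [disjoint_left]
    rintro _ ⟨x, hx, rfl⟩ ⟨y, hy, hxy⟩
    exact huv (wordMap_pqrSystem_injective hp hq hr hK hone n u v (hEK hx) (hEK hy) hxy.symm)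
  · have : ∑ u, τ u ^ (s : ℝ) = (∑ i, pqrRatio p q r i ^ (s : ℝ)) ^ n * r ^ (s : ℝ) := by
      rw [Fintype.sum_pow, Finset.sum_mul]
      refine Finset.sum_congr rfl fun u _ => ?_
      rw [Real.mul_rpow (hprod u).le hr.1.le, Real.finsetProd_rpow _ _ fun k _ => (hρ _).1.le]
    rw [this]
    exact ((inv_lt_iff_one_lt_mul₀ hrs).1 hn).le

end

theorem exists_sum_rpow_eq_one {p q r : ℝ} (hp : p ∈ Ioo (0 : ℝ) (1 / 36))
    (hq : q ∈ Ioo (0 : ℝ) (1 / 36)) (hr : r ∈ Ioo (0 : ℝ) (1 / 36)) :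
    ∃ d : ℝ≥0, p ^ (d : ℝ) + q ^ (d : ℝ) + 4 * r ^ (d : ℝ) = 1 := by
  have hcont : Continuous fun t : ℝ => p ^ t + q ^ t + 4 * r ^ t :=
    ((Real.continuous_const_rpow hp.1.ne').add (Real.continuous_const_rpow hq.1.ne')).add
      ((Real.continuous_const_rpow hr.1.ne').const_mul 4)
  -- The left side is `6` at `t = 0` and less than `6 / 36` at `t = 1`.
  obtain ⟨t, ht, h⟩ := intermediate_value_Icc' (zero_le_one (α := ℝ)) hcont.continuousOn
    (show (1 : ℝ) ∈ _ by
      simp only [Real.rpow_one, Real.rpow_zero]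
      exact ⟨by linarith [hp.2, hq.2, hr.2], by norm_num⟩)
  exact ⟨⟨t, ht.1⟩, h⟩

theorem mainTheorem4 (p q r : ℝ) (hp : p ∈ Set.Ioo (0 : ℝ) (1 / 36))
    (hq : q ∈ Set.Ioo (0 : ℝ) (1 / 36)) (hr : r ∈ Set.Ioo (0 : ℝ) (1 / 36))
    (K : Set ℝ) (hK : IsAttractor (pqrSystem p q r) K)
    (hone : HasUniqueOnePointIntersection p q r K) :
    ∃ d : ℝ≥0, dimH K = d ∧ p ^ (d : ℝ) + q ^ (d : ℝ) + 4 * r ^ (d : ℝ) = 1 := by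
  obtain ⟨d, hd⟩ := exists_sum_rpow_eq_one hp hq hr
  have hρ := pqrRatio_mem_Ioo hp hq hr
  have hsum := (sum_pqrRatio_rpow p q r d).trans hd
  refine ⟨d, le_antisymm ?_ (ENNReal.le_of_forall_nnreal_lt fun s hs => ?_), hd⟩
  · refine hK.dimH_le (fun i => (hρ i).1) (c := 1 / 36) (by norm_num) (fun i => (hρ i).2.le)
      (dist_pqrSystem hp.1 hq.1 hr.1) ?_ hsum.le
    refine (Metric.diam_mono (hK.subset_Icc_of_pqrSystem hp hq hr) (Metric.isBounded_Icc 0 1)).trans ?_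
    rw [Real.diam_Icc zero_le_one, sub_zero]
  · rcases eq_zero_or_pos s with rfl | hs0
    · simp
    -- The ratios are below `1`, so each power strictly decreases in the exponent and the sum at `s
    -- < d` exceeds `1`.
    · refine le_dimH_of_one_lt_sum hp hq hr hK hone hs0 (hsum.symm.trans_lt ?_)
      refine Finset.sum_lt_sum_of_nonempty Finset.univ_nonempty fun i _ => ?_
      exact Real.rpow_lt_rpow_of_exponent_gt (hρ i).1 (by linarith [(hρ i).2])
        (NNReal.coe_lt_coe.2 (ENNReal.coe_lt_coe.1 hs))
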